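/- Let $S\subset\mathbb R^2$ be a (nondegenerate) triangle, i.e. the convex hull of three affinely independent points. For convex bodies (nonempty compact convex sets) $K$ and $C$ with $C$ full-dimensional put $$R(K,C)=\inf\{\rho\ge 0:\ K\subset t+\rho C\text{ for some }t\},\qquad r(K,C)=\sup\{\rho\ge 0:\ t+\rho C\subset K\text{ for some }t\},$$ and let $s(C)=R(C,-C)$. The body $C$ is called Minkowski-centered if $C\subset -s(C)C$ and $R(C,-s(C)C)=1$. If $0$ is an interior point of $C$ (which holds for every Minkowski-centered triangle), let $\|x\|_C=\min\{\lambda\ge 0: x\in\lambda C\}$ and define the harmonic diameter $$D_{HM}(K,C)=\max_{s\ne 0}\ \max\Big\{\tfrac12\big(\|x-y\|_C+\|x-y\|_{-C}\big):\ x,y\in K,\ x-y\in\mathrm{lin}(s)\Big\}.$$ Suppose that $S$ is Minkowski-centered. Then the diagram $$f_{HM}(S)=\left\{\left(\frac{r(K,S)}{R(K,S)},\frac{D_{HM}(K,S)}{2R(K,S)}\right):\ K\subset\mathbb R^2\text{ a convex body that is not a single point}\right\}$$ is fully described by the inequalities $$D\le 3R,\qquad 3r\le D,\qquad 0\le r,\qquad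 R\le \tfrac23 D,\qquad \tfrac49\left(\tfrac DR-\tfrac34\right)\left(\tfrac94-\tfrac DR\right)\le \tfrac rR .$$ That is: (i) for every planar convex body $K$ that is not a single point, $R(K,S)>0$ and the five inequalities hold for $r=r(K,S)$, $R=R(K,S)$, $D=D_{HM}(K,S)$; and (ii) $f_{HM}(S)$ is exactly the set of all points $\left(\frac rR,\frac D{2R}\right)$ with $r,R,D\in\mathbb R$, $R>0$, that satisfy the five inequalities. -/

import Mathlib

open scoped Pointwise

noncomputable section

/-- The Euclidean plane. -/
abbrev Plane : Type := EuclideanSpace ℝ (Fin 2)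

section Functionals

variable {E : Type*} [AddCommGroup E] [Module ℝ E]

/-- The circumradius `R(K, C)` of `K` with respect to the gauge body `C`. -/
def circumradius (K C : Set E) : ℝ :=
  sInf {ρ : ℝ | 0 ≤ ρ ∧ ∃ t : E, K ⊆ t +ᵥ ρ • C}

/-- The inradius `r(K, C)` of `K` with respect to the gauge body `C`. -/
def inradius (K C : Set E) : ℝ :=
  sSup {ρ : ℝ | 0 ≤ ρ ∧ ∃ t : E, t +ᵥ ρ • C ⊆ K}

/-- `K` is optimally contained in `C`: `K ⊆ C` and `R(K, C) = 1`. -/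
def OptimallyContained (K C : Set E) : Prop :=
  K ⊆ C ∧ circumradius K C = 1

/-- The Minkowski asymmetry `s(C) = R(C, -C)`. -/
def minkowskiAsymmetry (C : Set E) : ℝ :=
  circumradius C (-C)

/-- `C` is Minkowski-centered: `C` is optimally contained in `-s(C) C`. -/
def IsMinkowskiCentered (C : Set E) : Prop :=
  OptimallyContained C ((-minkowskiAsymmetry C) • C)

/-- The harmonic `s`-length of `K` with respect to `C`: the maximum of
`(‖x - y‖_C + ‖x - y‖_{-C}) / 2` over `x, y ∈ K` with `x - y` in the line spanned by `s`,
where `‖·‖_C` is the gauge function of `C`. -/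
def harmonicLength (s : E) (K C : Set E) : ℝ :=
  sSup {l : ℝ | ∃ x ∈ K, ∃ y ∈ K, x - y ∈ Submodule.span ℝ {s} ∧
    l = (gauge C (x - y) + gauge (-C) (x - y)) / 2}

/-- The harmonic diameter `D_HM(K, C)`: the maximal harmonic `s`-length over all `s ≠ 0`. -/
def harmonicDiameter (K C : Set E) : ℝ :=
  sSup {l : ℝ | ∃ s : E, s ≠ 0 ∧ l = harmonicLength s K C}

/-- A (nondegenerate) triangle: the convex hull of three affinely independent points. -/
def IsTriangle (S : Set E) : Prop :=
  ∃ p : Fin 3 → E, AffineIndependent ℝ p ∧ S = convexHull ℝ (Set.range p)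

end Functionals

/-- The Blaschke–Santaló diagram for the inradius, circumradius and harmonic diameter with regard
to the planar gauge `C`: the set of all points `(r(K, C) / R(K, C), D_HM(K, C) / (2 R(K, C)))`,
where `K` ranges over the planar convex bodies that are not single points. -/
def harmonicDiagram (C : Set Plane) : Set (ℝ × ℝ) :=
  {p : ℝ × ℝ | ∃ K : ConvexBody Plane, (K : Set Plane).Nontrivial ∧
    p = (inradius (K : Set Plane) C / circumradius (K : Set Plane) C,
      harmonicDiameter (K : Set Plane) C / (2 * circumradius (K : Set Plane) C))}

/-- The system of five inequalities for the inradius `r`, the circumradius `R` and the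
harmonic diameter `D` of a body. -/
def HarmonicTriangleSystem (r R D : ℝ) : Prop :=
  D ≤ 3 * R ∧
  3 * r ≤ D ∧
  0 ≤ r ∧
  R ≤ 2 / 3 * D ∧
  4 / 9 * (D / R - 3 / 4) * (9 / 4 - D / R) ≤ r / R

end

/-!
The origin is the centroid of a Minkowski-centered triangle `S`, so `S = {x | ∀ i, a i x ≤ 1}` for
three linear functionals `a 0, a 1, a 2` with sum zero (`IsTriangle.exists_functionals`). Everything
is then read off from these functionals. With `h i = max a i` over a body `K`, the circumradius is
`R = (h 0 + h 1 + h 2) / 3` (`circumradius_eq`), and `{x | ∀ i, a i x ≤ h i}` is the circumscribed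
homothet of `S`. Twice the harmonic diameter `D` is the largest width of `K` with respect to the
differences `a i - a j` (`harmonicDiameter_le_iff`). The linear inequalities follow from these two
formulas.

For the quadratic inequality, choose `P i ∈ K` with `a i (P i) = h i`. The points `P i` lie on the
three sides of the circumscribed triangle, at positions `s₀, s₁, s₂ ∈ [0, 1]`, and they span a
triangle that contains a translate of `Δ R S` with
`Δ = s₀ s₁ s₂ + (1 - s₀) (1 - s₁) (1 - s₂) = 1 - (s₀ + s₁ + s₂) + (s₀ s₁ + s₁ s₂ + s₂ s₀)`
(`exists_vadd_smul_subset`). The widths give `D ≥ 3 R (1 + s i - s (i + 1)) / 2` for cyclic indices,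
and these three inequalities bound `Δ` below by `1 / 4 - (2 D / (3 R) - 1) ^ 2`
(`quadratic_le_of_cyclic_diff_le`).

Conversely, write `D = 3 (1 + e) / 2` with `R = 1`. Equality in the lower bound for the inradius is
attained by an inscribed triangle, which degenerates to a segment for `e ≥ 1 / 2`. There is a
homothet `(D / 3) S + v` such that the convex hull of it and the inscribed triangle still has
circumradius `1` and diameter `D`. Replacing this homothet by smaller ones, down to the
largest one inside the inscribed triangle, gives all intermediate inradii
(`exists_convexBody`): the three outer normals of the inscribed triangle certify that the
convex hull contains no larger homothet.
-/

/-! ### Functionals describing a centred triangle -/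

/-- The linear functionals `a 0`, `a 1`, `a 2` describe `S` as the triangle `{x | ∀ i, a i x ≤ 1}`
with centroid `0`. In terms of the barycentric coordinates `l i` with respect to the vertices of
`S`, they are `a i = 1 - 3 * l i`. -/
structure IsTriangleFunctionals (S : Set Plane) (a : Fin 3 → Plane →ₗ[ℝ] ℝ) : Prop where
  sum_eq_zero : ∀ x, a 0 x + a 1 x + a 2 x = 0
  mem_iff : ∀ x, x ∈ S ↔ ∀ i, a i x ≤ 1
  exists_eq : ∀ c : Fin 3 → ℝ, c 0 + c 1 + c 2 = 0 → ∃ x, ∀ i, a i x = c i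
  eq_zero : ∀ x, (∀ i, a i x = 0) → x = 0
  exists_finite : ∃ V : Set Plane, V.Finite ∧ S = convexHull ℝ V

/-- For a Minkowski-centered triangle the barycentric coordinates of the origin are all equal:
the asymmetry is at most `2`, so `S ⊆ -2 S` forces each of them to be at least `1 / 3`. -/
theorem IsTriangle.exists_functionals {S : Set Plane} (hS : IsTriangle S)
    (hc : IsMinkowskiCentered S) : ∃ a, IsTriangleFunctionals S a := by
  obtain ⟨p, hp, rfl⟩ := hS
  have htop : affineSpan ℝ (Set.range p) = ⊤ := by
    rw [hp.affineSpan_eq_top_iff_card_eq_finrank_add_one]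
    simp
  set b : AffineBasis (Fin 3) ℝ Plane := ⟨p, hp, htop⟩ with hb
  have hbp : Set.range p = Set.range b := rfl
  have hmem : ∀ x, x ∈ convexHull ℝ (Set.range p) ↔ ∀ i, 0 ≤ b.coord i x := by
    intro x
    rw [hbp, b.convexHull_eq_nonneg_coord]
    rfl
  have hlin : ∀ i x, b.coord i x = (b.coord i).linear x + b.coord i 0 := by
    intro i x
    have := (b.coord i).map_vadd 0 x
    simpa using this
  have hsum : ∀ x, b.coord 0 x + b.coord 1 x + b.coord 2 x = 1 := by
    intro x
    have := b.sum_coord_apply_eq_one x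
    rwa [Fin.sum_univ_three] at this
  have hvert : ∀ i j, b.coord i (p j) = if i = j then 1 else 0 := fun i j => b.coord_apply i j
  set S := convexHull ℝ (Set.range p) with hSdef
  set s := minkowskiAsymmetry S with hs
  have hs0 : 0 ≤ s := Real.sInf_nonneg fun _ h => h.1
  have hs2 : s ≤ 2 := by
    refine csInf_le ⟨0, fun _ h => h.1⟩ ⟨by norm_num, p 0 + p 1 + p 2, ?_⟩
    intro x hx
    rw [Set.mem_vadd_set]
    refine ⟨x - (p 0 + p 1 + p 2), ?_, by simp⟩
    rw [Set.mem_smul_set]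
    refine ⟨(2⁻¹ : ℝ) • (x - (p 0 + p 1 + p 2)), ?_, by simp [smul_smul]⟩
    rw [Set.mem_neg, hmem]
    intro i
    have h1 := hlin i x
    have hx' := (hmem x).1 hx
    have h2 : b.coord i (p 0) + b.coord i (p 1) + b.coord i (p 2) = 1 := by
      fin_cases i <;> simp [hvert]
    rw [hlin i (p 0), hlin i (p 1), hlin i (p 2)] at h2
    rw [hlin, ← smul_neg, map_smul, map_neg, map_sub, map_add, map_add, smul_eq_mul]
    have h3 : b.coord i x ≤ 1 := by
      have := hsum x
      have h0 := hx' 0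
      have h1 := hx' 1
      have h2 := hx' 2
      fin_cases i <;> simp <;> linarith
    linarith
  have hge : ∀ i, 1 / 3 ≤ b.coord i 0 := by
    intro i
    have hi : p i ∈ S := subset_convexHull ℝ _ ⟨i, rfl⟩
    obtain ⟨y, hy, hyp⟩ := Set.mem_smul_set.1 (hc.1 hi)
    have h1 := (hmem y).1 hy i
    have h2 := hvert i i
    rw [← hyp, hlin, map_smul, smul_eq_mul] at h2
    rw [hlin] at h1
    simp only [if_true] at h2
    have h3 : 1 ≤ (s + 1) * b.coord i 0 := by nlinarith
    nlinarith
  have h13 : ∀ i, b.coord i 0 = 1 / 3 := by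
    have h0 := hge 0
    have h1 := hge 1
    have h2 := hge 2
    have := hsum 0
    intro i
    fin_cases i <;> simp <;> linarith
  have hl : ∀ i x, (b.coord i).linear x = b.coord i x - 1 / 3 := by
    intro i x
    rw [hlin, h13]
    ring
  refine ⟨fun i => (-3 : ℝ) • (b.coord i).linear, ?_, ?_, ?_, ?_, ?_⟩
  · intro x
    have := hsum x
    simp only [LinearMap.smul_apply, smul_eq_mul, hl]
    linarith
  · intro x
    rw [hmem]
    refine forall_congr' fun i => ?_
    simp only [LinearMap.smul_apply, smul_eq_mul, hl]
    constructor <;> intro h <;> linarith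
  · intro c hc0
    refine ⟨∑ j, ((1 - c j) / 3) • p j, fun i => ?_⟩
    rw [LinearMap.smul_apply, map_sum, Fin.sum_univ_three, map_smul, map_smul, map_smul, hl, hl, hl,
      hvert, hvert, hvert]
    fin_cases i <;> simp <;> linarith
  · intro x hx
    refine b.ext_elem fun i => ?_
    have := hx i
    simp only [LinearMap.smul_apply, smul_eq_mul, hl] at this
    rw [h13]
    linarith
  · exact ⟨_, Set.finite_range p, rfl⟩

namespace IsTriangleFunctionals

variable {S : Set Plane} {a : Fin 3 → Plane →ₗ[ℝ] ℝ}

theorem ext (ha : IsTriangleFunctionals S a) {x y : Plane} (h : ∀ i, a i x = a i y) : x = y :=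
  sub_eq_zero.1 (ha.eq_zero _ fun i => by rw [map_sub, h, sub_self])

theorem zero_mem (ha : IsTriangleFunctionals S a) : (0 : Plane) ∈ S :=
  (ha.mem_iff 0).2 fun i => by simp

theorem continuous (a : Fin 3 → Plane →ₗ[ℝ] ℝ) (i : Fin 3) : Continuous (a i) :=
  (a i).continuous_of_finiteDimensional

theorem mem_smul_iff (ha : IsTriangleFunctionals S a) {r : ℝ} (hr : 0 ≤ r) (x : Plane) :
    x ∈ r • S ↔ ∀ i, a i x ≤ r := by
  rcases hr.eq_or_lt with rfl | hr
  · rw [Set.zero_smul_set ⟨0, ha.zero_mem⟩, Set.mem_zero]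
    refine ⟨by rintro rfl; simp, fun h => ha.eq_zero x fun i => ?_⟩
    have h0 := h 0
    have h1 := h 1
    have h2 := h 2
    have := ha.sum_eq_zero x
    fin_cases i <;> simp <;> linarith
  · rw [Set.mem_smul_set_iff_inv_smul_mem₀ hr.ne', ha.mem_iff]
    refine forall_congr' fun i => ?_
    rw [map_smul, smul_eq_mul, inv_mul_le_iff₀ hr, mul_one]

theorem mem_vadd_smul_iff (ha : IsTriangleFunctionals S a) {r : ℝ} (hr : 0 ≤ r) (t x : Plane) :
    x ∈ t +ᵥ r • S ↔ ∀ i, a i x ≤ a i t + r := by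
  rw [Set.mem_vadd_set_iff_neg_vadd_mem, ha.mem_smul_iff hr]
  refine forall_congr' fun i => ?_
  rw [vadd_eq_add, map_add, map_neg]
  constructor <;> intro h <;> linarith

/-- The gauge of `S` is the maximum of the three functionals. -/
theorem gauge_le_iff (ha : IsTriangleFunctionals S a) (x : Plane) (M : ℝ) :
    gauge S x ≤ M ↔ ∀ i, a i x ≤ M := by
  have hnonneg : ∀ N : ℝ, (∀ i, a i x ≤ N) → 0 ≤ N := by
    intro N h
    have h0 := h 0
    have h1 := h 1
    have h2 := h 2
    have := ha.sum_eq_zero x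
    linarith
  constructor
  · intro h i
    refine le_trans ?_ h
    rw [gauge_def]
    obtain ⟨N, hN⟩ : ∃ N : ℝ, ∀ i, a i x ≤ N :=
      ⟨∑ j, |a j x|, fun i => (le_abs_self _).trans
        (Finset.single_le_sum (f := fun j => |a j x|) (fun _ _ => abs_nonneg _)
          (Finset.mem_univ i))⟩
    refine le_csInf ⟨N + 1, ?_, ?_⟩ ?_
    · have := hnonneg N hN
      simp only [Set.mem_Ioi]
      linarith
    · have := hnonneg N hN
      exact (ha.mem_smul_iff (by linarith) x).2 fun i => (hN i).trans (by linarith)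
    · rintro r ⟨hr, hx⟩
      exact (ha.mem_smul_iff (le_of_lt hr) x).1 hx i
  · intro h
    exact gauge_le_of_mem (hnonneg M h) ((ha.mem_smul_iff (hnonneg M h) x).2 h)

theorem gauge_add_gauge_neg_le_iff (ha : IsTriangleFunctionals S a) (x : Plane) (M : ℝ) :
    (gauge S x + gauge (-S) x) / 2 ≤ M ↔ ∀ i j, a i x - a j x ≤ 2 * M := by
  rw [gauge_neg_set_eq_gauge_neg]
  constructor
  · intro h i j
    have h1 := (ha.gauge_le_iff x _).1 le_rfl i
    have h2 := (ha.gauge_le_iff (-x) _).1 le_rfl j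
    rw [map_neg] at h2
    linarith
  · intro h
    have h1 : ∀ j, gauge S x ≤ 2 * M + a j x := fun j =>
      (ha.gauge_le_iff x _).2 fun i => by linarith [h i j]
    have h2 : gauge S (-x) ≤ 2 * M - gauge S x :=
      (ha.gauge_le_iff (-x) _).2 fun j => by rw [map_neg]; linarith [h1 j]
    linarith

/-! ### Circumradius, inradius and harmonic diameter in terms of the functionals -/

theorem exists_forall_le_of_isCompact {K : Set Plane} (hK : IsCompact K)
    (a : Fin 3 → Plane →ₗ[ℝ] ℝ) : ∃ B : ℝ, ∀ x ∈ K, ∀ i, |a i x| ≤ B := by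
  have h : ∀ i, ∃ B : ℝ, ∀ x ∈ K, |a i x| ≤ B := fun i => by
    obtain ⟨B, hB⟩ := hK.exists_bound_of_continuousOn (continuous a i).continuousOn
    exact ⟨B, fun x hx => by simpa using hB x hx⟩
  choose B hB using h
  refine ⟨∑ i, |B i|, fun x hx i => ((hB i x hx).trans (le_abs_self _)).trans ?_⟩
  exact Finset.single_le_sum (f := fun j => |B j|) (fun _ _ => abs_nonneg _) (Finset.mem_univ i)

/-- The harmonic diameter is half the largest width of the body with respect to the
differences `a i - a j`. -/
theorem harmonicDiameter_le_iff (ha : IsTriangleFunctionals S a) {K : Set Plane}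
    (hK : IsCompact K) (hne : K.Nonempty) (M : ℝ) :
    harmonicDiameter K S ≤ M ↔
      ∀ x ∈ K, ∀ y ∈ K, ∀ i j, a i (x - y) - a j (x - y) ≤ 2 * M := by
  have hlen : ∀ s : Plane, ∀ N : ℝ,
      (∀ x ∈ K, ∀ y ∈ K, ∀ i j, a i (x - y) - a j (x - y) ≤ 2 * N) →
      harmonicLength s K S ≤ N := by
    intro s N hN
    obtain ⟨x, hx⟩ := hne
    refine csSup_le ⟨_, x, hx, x, hx, by simp, rfl⟩ ?_
    rintro l ⟨x, hx, y, hy, -, rfl⟩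
    exact (ha.gauge_add_gauge_neg_le_iff _ _).2 (hN x hx y hy)
  obtain ⟨B, hB⟩ := exists_forall_le_of_isCompact hK a
  have hbd : ∀ x ∈ K, ∀ y ∈ K, ∀ i j, a i (x - y) - a j (x - y) ≤ 2 * (2 * B) := by
    intro x hx y hy i j
    rw [map_sub, map_sub]
    have h1 := abs_le.1 (hB x hx i)
    have h2 := abs_le.1 (hB x hx j)
    have h3 := abs_le.1 (hB y hy i)
    have h4 := abs_le.1 (hB y hy j)
    linarith [h1.1, h1.2, h2.1, h2.2, h3.1, h3.2, h4.1, h4.2]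
  have hBdd : BddAbove {l : ℝ | ∃ s : Plane, s ≠ 0 ∧ l = harmonicLength s K S} := by
    refine ⟨2 * B, ?_⟩
    rintro l ⟨s, -, rfl⟩
    exact hlen s _ hbd
  have hgauge : ∀ x ∈ K, ∀ y ∈ K, x ≠ y →
      (gauge S (x - y) + gauge (-S) (x - y)) / 2 ≤ harmonicDiameter K S := by
    intro x hx y hy hxy
    refine le_trans ?_ (le_csSup hBdd ⟨x - y, sub_ne_zero.2 hxy, rfl⟩)
    refine le_csSup ⟨2 * B, ?_⟩ ⟨x, hx, y, hy, Submodule.mem_span_singleton_self _, rfl⟩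
    rintro l ⟨x, hx, y, hy, -, rfl⟩
    exact (ha.gauge_add_gauge_neg_le_iff _ _).2 (hbd x hx y hy)
  constructor
  · intro h x hx y hy
    rcases eq_or_ne x y with rfl | hxy
    · have : 0 ≤ harmonicDiameter K S := by
        refine Real.sSup_nonneg ?_
        rintro l ⟨s, -, rfl⟩
        refine Real.sSup_nonneg ?_
        rintro l ⟨x, -, y, -, -, rfl⟩
        have h1 := gauge_nonneg (s := S) (x - y)
        have h2 := gauge_nonneg (s := -S) (x - y)
        linarith
      intro i j
      simp only [sub_self, map_zero]
      linarith
    · exact (ha.gauge_add_gauge_neg_le_iff _ _).1 ((hgauge x hx y hy hxy).trans h)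
  · intro h
    obtain ⟨s, hs⟩ := exists_ne (0 : Plane)
    refine csSup_le ⟨_, s, hs, rfl⟩ ?_
    rintro l ⟨s, -, rfl⟩
    exact hlen s M h

/-- The circumradius is the mean of the three support values of the body. -/
theorem circumradius_eq (ha : IsTriangleFunctionals S a) {K : Set Plane} {h : Fin 3 → ℝ}
    (hle : ∀ x ∈ K, ∀ i, a i x ≤ h i) (hatt : ∀ i, ∃ x ∈ K, a i x = h i) :
    circumradius K S = (h 0 + h 1 + h 2) / 3 := by
  obtain ⟨x, hx, -⟩ := hatt 0
  have hx' := hle x hx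
  have h0 := hx' 0
  have h1 := hx' 1
  have h2 := hx' 2
  have hsum := ha.sum_eq_zero x
  have hpos : 0 ≤ (h 0 + h 1 + h 2) / 3 := by linarith
  refine IsLeast.csInf_eq ⟨⟨hpos, ?_⟩, ?_⟩
  · obtain ⟨t, ht⟩ := ha.exists_eq (fun i => h i - (h 0 + h 1 + h 2) / 3) (by ring)
    refine ⟨t, fun y hy => (ha.mem_vadd_smul_iff hpos t y).2 fun i => ?_⟩
    rw [ht]
    linarith [hle y hy i]
  · rintro ρ ⟨hρ, t, ht⟩
    have key : ∀ i, h i ≤ a i t + ρ := fun i => by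
      obtain ⟨y, hy, hyi⟩ := hatt i
      rw [← hyi]
      exact (ha.mem_vadd_smul_iff hρ t y).1 (ht hy) i
    have k0 := key 0
    have k1 := key 1
    have k2 := key 2
    have := ha.sum_eq_zero t
    linarith

/-- A homothet `t + ρ S` has width `3 ρ` with respect to `a 0 - a 1`. -/
theorem le_harmonicDiameter_of_subset (ha : IsTriangleFunctionals S a) {K : Set Plane}
    (hK : IsCompact K) (hne : K.Nonempty) {ρ : ℝ} (hρ : 0 ≤ ρ) {t : Plane}
    (ht : t +ᵥ ρ • S ⊆ K) : 3 * ρ ≤ harmonicDiameter K S := by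
  obtain ⟨u, hu⟩ := ha.exists_eq ![a 0 t + ρ, a 1 t - 2 * ρ, a 2 t + ρ] (by
    have := ha.sum_eq_zero t
    simp
    linarith)
  obtain ⟨v, hv⟩ := ha.exists_eq ![a 0 t - 2 * ρ, a 1 t + ρ, a 2 t + ρ] (by
    have := ha.sum_eq_zero t
    simp
    linarith)
  have huK : u ∈ K := ht <| (ha.mem_vadd_smul_iff hρ t u).2 fun i => by
    rw [hu]
    fin_cases i <;> simp
    linarith
  have hvK : v ∈ K := ht <| (ha.mem_vadd_smul_iff hρ t v).2 fun i => by
    rw [hv]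
    fin_cases i <;> simp
    linarith
  have := (ha.harmonicDiameter_le_iff hK hne _).1 le_rfl u huK v hvK 0 1
  rw [map_sub, map_sub, hu, hu, hv, hv] at this
  simp at this
  linarith

theorem three_mul_inradius_le (ha : IsTriangleFunctionals S a) {K : Set Plane}
    (hK : IsCompact K) (hne : K.Nonempty) : 3 * inradius K S ≤ harmonicDiameter K S := by
  have : inradius K S ≤ harmonicDiameter K S / 3 := by
    obtain ⟨x, hx⟩ := id hne
    refine csSup_le ⟨0, le_rfl, x, ?_⟩ ?_
    · rw [Set.zero_smul_set ⟨0, ha.zero_mem⟩]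
      intro y hy
      obtain ⟨z, hz, rfl⟩ := Set.mem_vadd_set.1 hy
      rw [Set.mem_zero.1 hz]
      simpa using hx
    · rintro ρ ⟨hρ, t, ht⟩
      linarith [ha.le_harmonicDiameter_of_subset hK hne hρ ht]
  linarith

theorem le_inradius (ha : IsTriangleFunctionals S a) {K : Set Plane}
    (hK : IsCompact K) (hne : K.Nonempty) {ρ : ℝ} (hρ : 0 ≤ ρ) {t : Plane}
    (ht : t +ᵥ ρ • S ⊆ K) : ρ ≤ inradius K S := by
  refine le_csSup ⟨harmonicDiameter K S / 3, ?_⟩ ⟨hρ, t, ht⟩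
  rintro ρ ⟨hρ, t, ht⟩
  linarith [ha.le_harmonicDiameter_of_subset hK hne hρ ht]

end IsTriangleFunctionals

/-! ### Triangles inscribed in the circumscribed homothet -/

/-- Lower bound for the inradius of a triangle with one vertex on each side of `S`, at positions
`s₀, s₁, s₂`, whose diameter is at most `3 d / 2`; the right side is
`s₀ s₁ s₂ + (1 - s₀) (1 - s₁) (1 - s₂)`. With `s i = 1 / 2 + x i` it equals
`1 / 4 + x₀ x₁ + x₁ x₂ + x₂ x₀`, and the left side is `1 / 4 - (d - 1) ^ 2`. -/
theorem quadratic_le_of_cyclic_diff_le {s₀ s₁ s₂ d : ℝ} (h₀ : 1 + s₀ - s₁ ≤ d)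
    (h₁ : 1 + s₁ - s₂ ≤ d) (h₂ : 1 + s₂ - s₀ ≤ d) :
    (d - 1 / 2) * (3 / 2 - d) ≤ 1 - (s₀ + s₁ + s₂) + (s₀ * s₁ + s₁ * s₂ + s₂ * s₀) := by
  have h₀' := sub_nonneg.2 h₀
  have h₁' := sub_nonneg.2 h₁
  have h₂' := sub_nonneg.2 h₂
  nlinarith [mul_nonneg h₀' h₁', mul_nonneg h₁' h₂', mul_nonneg h₂' h₀',
    sq_nonneg (s₀ + s₁ + s₂ - 3 / 2)]

namespace IsTriangleFunctionals

variable {S : Set Plane} {a : Fin 3 → Plane →ₗ[ℝ] ℝ}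

/-- Let `P₀, P₁, P₂` lie on the three sides of the triangle `{x | ∀ i, a i x ≤ h i}`, which is
`R` times as large as `S`; the parameters `s i` give their positions on these sides. If
`Δ = 1 - (s₀ + s₁ + s₂) + (s₀ s₁ + s₁ s₂ + s₂ s₀)` is positive, then the triangle `P₀ P₁ P₂`
contains a translate of `Δ R S`. -/
theorem exists_vadd_smul_subset (ha : IsTriangleFunctionals S a) {K : Set Plane}
    (hK : Convex ℝ K) {h : Fin 3 → ℝ} {R s₀ s₁ s₂ : ℝ} (hR : 0 < R)
    (hsum : h 0 + h 1 + h 2 = 3 * R) {P₀ P₁ P₂ : Plane} (hP₀ : P₀ ∈ K) (hP₁ : P₁ ∈ K)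
    (hP₂ : P₂ ∈ K) (h₀ : 0 ≤ s₀ ∧ s₀ ≤ 1) (h₁ : 0 ≤ s₁ ∧ s₁ ≤ 1) (h₂ : 0 ≤ s₂ ∧ s₂ ≤ 1)
    (h00 : a 0 P₀ = h 0) (h01 : a 1 P₀ = h 1 - 3 * R * s₀)
    (h11 : a 1 P₁ = h 1) (h12 : a 2 P₁ = h 2 - 3 * R * s₁)
    (h22 : a 2 P₂ = h 2) (h20 : a 0 P₂ = h 0 - 3 * R * s₂)
    (hΔ : 0 < 1 - (s₀ + s₁ + s₂) + (s₀ * s₁ + s₁ * s₂ + s₂ * s₀)) :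
    ∃ t : Plane, t +ᵥ ((1 - (s₀ + s₁ + s₂) + (s₀ * s₁ + s₁ * s₂ + s₂ * s₀)) * R) • S ⊆ K := by
  have h02 : a 2 P₀ = h 2 - 3 * R * (1 - s₀) := by linarith [ha.sum_eq_zero P₀]
  have h10 : a 0 P₁ = h 0 - 3 * R * (1 - s₁) := by linarith [ha.sum_eq_zero P₁]
  have h21 : a 1 P₂ = h 1 - 3 * R * (1 - s₂) := by linarith [ha.sum_eq_zero P₂]
  set Δ := 1 - (s₀ + s₁ + s₂) + (s₀ * s₁ + s₁ * s₂ + s₂ * s₀) with hΔdef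
  -- In barycentric coordinates of the large triangle, the homothet consists of the points whose
  -- coordinates are at least `s₂ (1 - s₁)`, `s₀ (1 - s₂)`, `s₁ (1 - s₀)`.
  obtain ⟨t, ht⟩ := ha.exists_eq
    ![h 0 - 3 * R * (s₂ * (1 - s₁)) - Δ * R, h 1 - 3 * R * (s₀ * (1 - s₂)) - Δ * R,
      h 2 - 3 * R * (s₁ * (1 - s₀)) - Δ * R] (by
        simp only [Matrix.cons_val]
        rw [hΔdef]
        linear_combination hsum)
  refine ⟨t, fun x hx => ?_⟩
  rw [ha.mem_vadd_smul_iff (by positivity)] at hx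
  have hx0 := hx 0
  have hx1 := hx 1
  have hx2 := hx 2
  rw [ht] at hx0 hx1 hx2
  simp only [Matrix.cons_val, sub_add_cancel] at hx0 hx1 hx2
  obtain ⟨l0, hl0⟩ : ∃ l, a 0 x = h 0 - 3 * R * l := ⟨(h 0 - a 0 x) / (3 * R), by field_simp; ring⟩
  obtain ⟨l1, hl1⟩ : ∃ l, a 1 x = h 1 - 3 * R * l := ⟨(h 1 - a 1 x) / (3 * R), by field_simp; ring⟩
  obtain ⟨l2, hl2⟩ : ∃ l, a 2 x = h 2 - 3 * R * l := ⟨(h 2 - a 2 x) / (3 * R), by field_simp; ring⟩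
  have hl : l0 + l1 + l2 = 1 := by
    have := ha.sum_eq_zero x
    rw [hl0, hl1, hl2] at this
    have h3 : 3 * R * (l0 + l1 + l2) = 3 * R * 1 := by linarith
    exact mul_left_cancel₀ (by positivity) h3
  have hR3 : 0 < 3 * R := by positivity
  have hm0 : s₂ * (1 - s₁) ≤ l0 := le_of_mul_le_mul_left (by linarith) hR3
  have hm1 : s₀ * (1 - s₂) ≤ l1 := le_of_mul_le_mul_left (by linarith) hR3
  have hm2 : s₁ * (1 - s₀) ≤ l2 := le_of_mul_le_mul_left (by linarith) hR3
  -- The weights of the `P i` come from Cramer's rule, with determinant `Δ`.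
  obtain ⟨w0, hw0⟩ : ∃ w, Δ * w = s₁ * l1 + (1 - s₂) * l2 - s₁ * (1 - s₂) :=
    ⟨_, mul_div_cancel₀ _ hΔ.ne'⟩
  obtain ⟨w1, hw1⟩ : ∃ w, Δ * w = s₂ * l2 + (1 - s₀) * l0 - s₂ * (1 - s₀) :=
    ⟨_, mul_div_cancel₀ _ hΔ.ne'⟩
  obtain ⟨w2, hw2⟩ : ∃ w, Δ * w = s₀ * l0 + (1 - s₁) * l1 - s₀ * (1 - s₁) :=
    ⟨_, mul_div_cancel₀ _ hΔ.ne'⟩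
  have hw0' : 0 ≤ w0 := nonneg_of_mul_nonneg_right (by
    linarith [mul_le_mul_of_nonneg_left hm1 h₁.1,
      mul_le_mul_of_nonneg_left hm2 (sub_nonneg.2 h₂.2)]) hΔ
  have hw1' : 0 ≤ w1 := nonneg_of_mul_nonneg_right (by
    linarith [mul_le_mul_of_nonneg_left hm2 h₂.1,
      mul_le_mul_of_nonneg_left hm0 (sub_nonneg.2 h₀.2)]) hΔ
  have hw2' : 0 ≤ w2 := nonneg_of_mul_nonneg_right (by
    linarith [mul_le_mul_of_nonneg_left hm0 h₀.1,
      mul_le_mul_of_nonneg_left hm1 (sub_nonneg.2 h₁.2)]) hΔ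
  have hwsum : w0 + w1 + w2 = 1 := mul_left_cancel₀ hΔ.ne' (by
    rw [mul_add, mul_add, hw0, hw1, hw2, hΔdef]
    linear_combination hl)
  have e0 : l0 = w1 * (1 - s₁) + w2 * s₂ := mul_left_cancel₀ hΔ.ne' (by
    linear_combination l0 * hΔdef + (s₂ * (s₁ - 1)) * hl - (1 - s₁) * hw1 - s₂ * hw2)
  have e1 : l1 = w2 * (1 - s₂) + w0 * s₀ := mul_left_cancel₀ hΔ.ne' (by
    linear_combination l1 * hΔdef + (s₀ * (s₂ - 1)) * hl - (1 - s₂) * hw2 - s₀ * hw0)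
  have e2 : l2 = w0 * (1 - s₀) + w1 * s₁ := mul_left_cancel₀ hΔ.ne' (by
    linear_combination l2 * hΔdef + (s₁ * (s₀ - 1)) * hl - (1 - s₀) * hw0 - s₁ * hw1)
  have hx : x = ∑ i, ![w0, w1, w2] i • ![P₀, P₁, P₂] i := by
    refine ha.ext fun i => ?_
    rw [Fin.sum_univ_three, map_add, map_add, map_smul, map_smul, map_smul]
    simp only [Matrix.cons_val, smul_eq_mul]
    fin_cases i
    · simp only [Fin.zero_eta]
      rw [hl0, h00, h10, h20]
      linear_combination (-3 * R) * e0 - h 0 * hwsum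
    · simp only [Fin.mk_one]
      rw [hl1, h01, h11, h21]
      linear_combination (-3 * R) * e1 - h 1 * hwsum
    · simp only [Fin.reduceFinMk]
      rw [hl2, h02, h12, h22]
      linear_combination (-3 * R) * e2 - h 2 * hwsum
  rw [hx]
  refine hK.sum_mem (fun i _ => ?_) (by simpa [Fin.sum_univ_three] using hwsum) fun i _ => ?_
  · fin_cases i <;> assumption
  · fin_cases i <;> assumption

end IsTriangleFunctionals

/-! ### The five inequalities -/

namespace IsTriangleFunctionals

variable {S : Set Plane} {a : Fin 3 → Plane →ₗ[ℝ] ℝ}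

theorem harmonicTriangleSystem (ha : IsTriangleFunctionals S a) (K : ConvexBody Plane)
    (hK : (K : Set Plane).Nontrivial) :
    0 < circumradius (K : Set Plane) S ∧
      HarmonicTriangleSystem (inradius (K : Set Plane) S) (circumradius (K : Set Plane) S)
        (harmonicDiameter (K : Set Plane) S) := by
  have hmax : ∀ i, ∃ x ∈ (K : Set Plane), ∀ y ∈ (K : Set Plane), a i y ≤ a i x := fun i =>
    K.isCompact.exists_isMaxOn K.nonempty (continuous a i).continuousOn
  choose P hPK hP using hmax
  set h : Fin 3 → ℝ := fun i => a i (P i) with hh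
  set R := circumradius (K : Set Plane) S with hRdef
  have hR : R = (h 0 + h 1 + h 2) / 3 :=
    ha.circumradius_eq (fun x hx i => hP i x hx) fun i => ⟨P i, hPK i, rfl⟩
  have hsum : h 0 + h 1 + h 2 = 3 * R := by linarith
  have hle : ∀ x ∈ (K : Set Plane), ∀ i, a i x ≤ h i := fun x hx i => hP i x hx
  have hRpos : 0 < R := by
    by_contra hneg
    obtain ⟨x, hx, y, hy, hxy⟩ := hK
    have heq : ∀ z ∈ (K : Set Plane), ∀ i, a i z = h i := by
      intro z hz i
      have h0 := hle z hz 0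
      have h1 := hle z hz 1
      have h2 := hle z hz 2
      have := ha.sum_eq_zero z
      fin_cases i <;> simp <;> linarith
    exact hxy (ha.ext fun i => by rw [heq x hx, heq y hy])
  set D := harmonicDiameter (K : Set Plane) S with hDdef
  set r := inradius (K : Set Plane) S with hrdef
  have hD := (ha.harmonicDiameter_le_iff K.isCompact K.nonempty D).1 le_rfl
  have hD01 := hD _ (hPK 0) _ (hPK 1) 0 1
  have hD12 := hD _ (hPK 1) _ (hPK 2) 1 2
  have hD20 := hD _ (hPK 2) _ (hPK 0) 2 0
  rw [map_sub, map_sub] at hD01 hD12 hD20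
  have e0 := ha.sum_eq_zero (P 0)
  have e1 := ha.sum_eq_zero (P 1)
  have e2 := ha.sum_eq_zero (P 2)
  have hr0 : 0 ≤ r := Real.sSup_nonneg fun _ h => h.1
  refine ⟨hRpos, ?_, ha.three_mul_inradius_le K.isCompact K.nonempty, hr0, ?_, ?_⟩
  · rw [hDdef, ha.harmonicDiameter_le_iff K.isCompact K.nonempty]
    intro x hx y hy i j
    have x0 := hle x hx 0
    have x1 := hle x hx 1
    have x2 := hle x hx 2
    have y0 := hle y hy 0
    have y1 := hle y hy 1
    have y2 := hle y hy 2
    have sx := ha.sum_eq_zero x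
    have sy := ha.sum_eq_zero y
    rw [map_sub, map_sub]
    fin_cases i <;> fin_cases j <;> simp <;> linarith
  · have h0 : a 0 (P 0) = h 0 := rfl
    have h1 : a 1 (P 1) = h 1 := rfl
    have h2 : a 2 (P 2) = h 2 := rfl
    linarith
  · obtain ⟨s₀, hs₀⟩ : ∃ s, a 1 (P 0) = h 1 - 3 * R * s :=
      ⟨(h 1 - a 1 (P 0)) / (3 * R), by field_simp; ring⟩
    obtain ⟨s₁, hs₁⟩ : ∃ s, a 2 (P 1) = h 2 - 3 * R * s :=
      ⟨(h 2 - a 2 (P 1)) / (3 * R), by field_simp; ring⟩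
    obtain ⟨s₂, hs₂⟩ : ∃ s, a 0 (P 2) = h 0 - 3 * R * s :=
      ⟨(h 0 - a 0 (P 2)) / (3 * R), by field_simp; ring⟩
    have h00 : a 0 (P 0) = h 0 := rfl
    have h11 : a 1 (P 1) = h 1 := rfl
    have h22 : a 2 (P 2) = h 2 := rfl
    have hR3 : 0 < 3 * R := by positivity
    have b0 : 0 ≤ s₀ ∧ s₀ ≤ 1 :=
      ⟨nonneg_of_mul_nonneg_right (by linarith [hle _ (hPK 0) 1]) hR3,
        le_of_mul_le_mul_left (by linarith [hle _ (hPK 0) 2]) hR3⟩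
    have b1 : 0 ≤ s₁ ∧ s₁ ≤ 1 :=
      ⟨nonneg_of_mul_nonneg_right (by linarith [hle _ (hPK 1) 2]) hR3,
        le_of_mul_le_mul_left (by linarith [hle _ (hPK 1) 0]) hR3⟩
    have b2 : 0 ≤ s₂ ∧ s₂ ≤ 1 :=
      ⟨nonneg_of_mul_nonneg_right (by linarith [hle _ (hPK 2) 0]) hR3,
        le_of_mul_le_mul_left (by linarith [hle _ (hPK 2) 1]) hR3⟩
    have d0 : 1 + s₀ - s₁ ≤ 2 / 3 * (D / R) := by
      rw [← mul_div_assoc, le_div_iff₀ hRpos]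
      linarith
    have d1 : 1 + s₁ - s₂ ≤ 2 / 3 * (D / R) := by
      rw [← mul_div_assoc, le_div_iff₀ hRpos]
      linarith
    have d2 : 1 + s₂ - s₀ ≤ 2 / 3 * (D / R) := by
      rw [← mul_div_assoc, le_div_iff₀ hRpos]
      linarith
    have hΔ := quadratic_le_of_cyclic_diff_le d0 d1 d2
    have hlhs : 4 / 9 * (D / R - 3 / 4) * (9 / 4 - D / R) ≤
        1 - (s₀ + s₁ + s₂) + (s₀ * s₁ + s₁ * s₂ + s₂ * s₀) := by
      linarith
    refine hlhs.trans ?_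
    rw [le_div_iff₀ hRpos]
    rcases le_or_gt (1 - (s₀ + s₁ + s₂) + (s₀ * s₁ + s₁ * s₂ + s₂ * s₀)) 0 with hneg | hpos
    · exact (mul_nonpos_of_nonpos_of_nonneg hneg hRpos.le).trans hr0
    · obtain ⟨t, ht⟩ := ha.exists_vadd_smul_subset K.convex hRpos hsum (hPK 0) (hPK 1) (hPK 2)
        b0 b1 b2 h00 hs₀ h11 hs₁ h22 hs₂ hpos
      exact ha.le_inradius K.isCompact K.nonempty (by positivity) ht

end IsTriangleFunctionals

/-! ### Bodies attaining all admissible values -/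

namespace IsTriangleFunctionals

variable {S : Set Plane} {a : Fin 3 → Plane →ₗ[ℝ] ℝ}

/-- Construction of a body with circumradius `1`, diameter `3 (1 + e) / 2` and inradius `ρ`.

Let `l i = (1 - a i) / 3` be the barycentric coordinates with respect to `S`. The body is the convex
hull of the inscribed triangle with vertices `(0, s₀, 1 - s₀)`, `(1 - s₁, 0, s₁)`,
`(s₂, 1 - s₂, 0)` and of the homothet `{l i ≥ k i}` of `S`, where `∑ i, k i = 1 - ρ`. The homothet
grows from `{l i ≥ m i}`, the largest one contained in the inscribed triangle, with
`m = (s₂ (1 - s₁), s₀ (1 - s₂), s₁ (1 - s₀))`, to `{l i ≥ n i}`, the largest one that the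
diameter allows. -/
theorem exists_convexBody (ha : IsTriangleFunctionals S a) {e ρ s₀ s₁ s₂ : ℝ} {n : Fin 3 → ℝ}
    (he : 0 ≤ e) (hρ : 0 ≤ ρ)
    (h₀ : 0 ≤ s₀ ∧ s₀ ≤ 1) (h₁ : 0 ≤ s₁ ∧ s₁ ≤ 1) (h₂ : 0 ≤ s₂ ∧ s₂ ≤ 1) (hs : s₁ - s₂ = e)
    (hn : ∀ i, 0 ≤ n i) (hnsum : n 0 + n 1 + n 2 = (1 - e) / 2)
    (hnm : ∀ i, n i ≤ ![s₂ * (1 - s₁), s₀ * (1 - s₂), s₁ * (1 - s₀)] i)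
    (hP₀ : ∀ i j, ![0, s₀, 1 - s₀] i - n i - (![0, s₀, 1 - s₀] j - n j) ≤ (1 + e) / 2)
    (hP₁ : ∀ i j, ![1 - s₁, 0, s₁] i - n i - (![1 - s₁, 0, s₁] j - n j) ≤ (1 + e) / 2)
    (hP₂ : ∀ i j, ![s₂, 1 - s₂, 0] i - n i - (![s₂, 1 - s₂, 0] j - n j) ≤ (1 + e) / 2)
    (hΔρ : 1 - (s₀ + s₁ + s₂) + (s₀ * s₁ + s₁ * s₂ + s₂ * s₀) ≤ ρ) (hρe : ρ ≤ (1 + e) / 2)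
    (hΔe : 1 - (s₀ + s₁ + s₂) + (s₀ * s₁ + s₁ * s₂ + s₂ * s₀) < (1 + e) / 2) :
    ∃ K : ConvexBody Plane, (K : Set Plane).Nontrivial ∧ circumradius (K : Set Plane) S = 1 ∧
      inradius (K : Set Plane) S = ρ ∧ harmonicDiameter (K : Set Plane) S = 3 / 2 * (1 + e) := by
  obtain ⟨k, hnk, hkm, hksum⟩ : ∃ k : Fin 3 → ℝ, (∀ i, n i ≤ k i) ∧
      (∀ i, k i ≤ ![s₂ * (1 - s₁), s₀ * (1 - s₂), s₁ * (1 - s₀)] i) ∧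
      k 0 + k 1 + k 2 = 1 - ρ := by
    set m := ![s₂ * (1 - s₁), s₀ * (1 - s₂), s₁ * (1 - s₀)] with hm
    set Δ := 1 - (s₀ + s₁ + s₂) + (s₀ * s₁ + s₁ * s₂ + s₂ * s₀) with hΔ
    have hpos : 0 < (1 + e) / 2 - Δ := sub_pos.2 hΔe
    have hmsum : m 0 + m 1 + m 2 = 1 - Δ := by
      simp only [hm, Matrix.cons_val]
      rw [hΔ]
      ring
    obtain ⟨θ, hθ⟩ : ∃ θ, ((1 + e) / 2 - Δ) * θ = ρ - Δ := ⟨_, mul_div_cancel₀ _ hpos.ne'⟩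
    have hθ0 : 0 ≤ θ := nonneg_of_mul_nonneg_right (by linarith) hpos
    have hθ1 : θ ≤ 1 := le_of_mul_le_mul_left (by linarith) hpos
    refine ⟨fun i => m i + θ * (n i - m i), fun i => ?_, fun i => ?_, ?_⟩
    · nlinarith [mul_nonneg (sub_nonneg.2 hθ1) (sub_nonneg.2 (hnm i))]
    · nlinarith [mul_nonneg hθ0 (sub_nonneg.2 (hnm i))]
    · linear_combination (1 - θ) * hmsum + θ * hnsum - hθ
  obtain ⟨P₀, p₀⟩ := ha.exists_eq (fun i => 1 - 3 * ![0, s₀, 1 - s₀] i)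
    (by simp only [Matrix.cons_val]; ring)
  obtain ⟨P₁, p₁⟩ := ha.exists_eq (fun i => 1 - 3 * ![1 - s₁, 0, s₁] i)
    (by simp only [Matrix.cons_val]; ring)
  obtain ⟨P₂, p₂⟩ := ha.exists_eq (fun i => 1 - 3 * ![s₂, 1 - s₂, 0] i)
    (by simp only [Matrix.cons_val]; ring)
  obtain ⟨t, ht⟩ := ha.exists_eq (fun i => 1 - 3 * k i - ρ) (by linear_combination -3 * hksum)
  obtain ⟨V, hVfin, hSV⟩ := ha.exists_finite
  have hfin : ({P₀, P₁, P₂} ∪ (t +ᵥ ρ • V) : Set Plane).Finite :=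
    (Set.toFinite _).union (hVfin.smul_set.vadd_set)
  set A : Set Plane := convexHull ℝ ({P₀, P₁, P₂} ∪ (t +ᵥ ρ • V)) with hA
  have hsub : {P₀, P₁, P₂} ∪ (t +ᵥ ρ • V) ⊆ A := subset_convexHull ℝ _
  have m₀ : P₀ ∈ A := hsub (by simp)
  have m₁ : P₁ ∈ A := hsub (by simp)
  have m₂ : P₂ ∈ A := hsub (by simp)
  have hTA : t +ᵥ ρ • S ⊆ A := by
    rw [hSV, ← convexHull_smul, ← convexHull_vadd]
    exact convexHull_mono Set.subset_union_right
  -- A linear inequality holds on the body if it holds at the `P i` and on the homothet.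
  have hle : ∀ (f : Plane →ₗ[ℝ] ℝ) (c : ℝ), f P₀ ≤ c → f P₁ ≤ c → f P₂ ≤ c →
      (∀ x, (∀ i, a i x ≤ 1 - 3 * k i) → f x ≤ c) → ∀ x ∈ A, f x ≤ c := by
    intro f c f0 f1 f2 hf
    refine convexHull_min ?_ (convex_halfSpace_le f.isLinear c)
    rintro x (hx | hx)
    · simp only [Set.mem_insert_iff, Set.mem_singleton_iff] at hx
      rcases hx with rfl | rfl | rfl <;> assumption
    · have hxS : x ∈ t +ᵥ ρ • S := by
        rw [hSV]
        exact Set.vadd_set_mono (Set.smul_set_mono (subset_convexHull ℝ V)) hx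
      rw [ha.mem_vadd_smul_iff hρ] at hxS
      refine hf x fun i => ?_
      have := hxS i
      rw [ht] at this
      linarith
  have hk : ∀ i, 0 ≤ k i := fun i => (hn i).trans (hnk i)
  have hone : ∀ x ∈ A, ∀ i, a i x ≤ 1 := by
    intro x hx i
    refine hle (a i) 1 ?_ ?_ ?_ ?_ x hx
    · rw [p₀]
      fin_cases i <;> simp <;> linarith
    · rw [p₁]
      fin_cases i <;> simp <;> linarith
    · rw [p₂]
      fin_cases i <;> simp <;> linarith
    · intro x hx
      linarith [hx i, hk i]
  have hdiff : ∀ x ∈ A, ∀ i j, a j x - a i x ≤ 3 * (n i - n j) + 3 * ((1 + e) / 2) := by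
    intro x hx i j
    refine hle (a j - a i) _ ?_ ?_ ?_ ?_ x hx
    · rw [LinearMap.sub_apply, p₀, p₀]
      linarith [hP₀ i j]
    · rw [LinearMap.sub_apply, p₁, p₁]
      linarith [hP₁ i j]
    · rw [LinearMap.sub_apply, p₂, p₂]
      linarith [hP₂ i j]
    · intro x hx
      rw [LinearMap.sub_apply]
      have x0 := (hx 0).trans (sub_le_sub_left (mul_le_mul_of_nonneg_left (hnk 0) zero_le_three) 1)
      have x1 := (hx 1).trans (sub_le_sub_left (mul_le_mul_of_nonneg_left (hnk 1) zero_le_three) 1)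
      have x2 := (hx 2).trans (sub_le_sub_left (mul_le_mul_of_nonneg_left (hnk 2) zero_le_three) 1)
      have sx := ha.sum_eq_zero x
      fin_cases i <;> fin_cases j <;> simp <;> linarith
  have hcomp : IsCompact A := hfin.isCompact_convexHull ℝ
  have hne : A.Nonempty := ⟨P₀, m₀⟩
  -- The inradius is controlled by the outer normals of the sides of the inscribed triangle.
  have hk0 : k 0 ≤ s₂ * (1 - s₁) := hkm 0
  have hk1 : k 1 ≤ s₀ * (1 - s₂) := hkm 1
  have hk2 : k 2 ≤ s₁ * (1 - s₀) := hkm 2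
  have hnorm : ∀ x ∈ A,
      s₁ * a 1 x + (1 - s₂) * a 2 x ≤ s₁ * (1 - 3 * k 1) + (1 - s₂) * (1 - 3 * k 2) ∧
      s₂ * a 2 x + (1 - s₀) * a 0 x ≤ s₂ * (1 - 3 * k 2) + (1 - s₀) * (1 - 3 * k 0) ∧
      s₀ * a 0 x + (1 - s₁) * a 1 x ≤ s₀ * (1 - 3 * k 0) + (1 - s₁) * (1 - 3 * k 1) := by
    have hu₀ := sub_nonneg.2 h₀.2
    have hu₁ := sub_nonneg.2 h₁.2
    have hu₂ := sub_nonneg.2 h₂.2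
    have hΔ : 0 ≤ s₀ * s₁ * s₂ + (1 - s₀) * (1 - s₁) * (1 - s₂) :=
      add_nonneg (mul_nonneg (mul_nonneg h₀.1 h₁.1) h₂.1) (mul_nonneg (mul_nonneg hu₀ hu₁) hu₂)
    have c1 : s₁ * k 1 + (1 - s₂) * k 2 ≤ s₁ * (1 - s₂) := by
      linarith [mul_le_mul_of_nonneg_left hk1 h₁.1, mul_le_mul_of_nonneg_left hk2 hu₂]
    have c2 : s₂ * k 2 + (1 - s₀) * k 0 ≤ s₂ * (1 - s₀) := by
      linarith [mul_le_mul_of_nonneg_left hk2 h₂.1, mul_le_mul_of_nonneg_left hk0 hu₀]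
    have c3 : s₀ * k 0 + (1 - s₁) * k 1 ≤ s₀ * (1 - s₁) := by
      linarith [mul_le_mul_of_nonneg_left hk0 h₀.1, mul_le_mul_of_nonneg_left hk1 hu₁]
    intro x hx
    refine ⟨hle (s₁ • a 1 + (1 - s₂) • a 2) _ ?_ ?_ ?_ ?_ x hx,
      hle (s₂ • a 2 + (1 - s₀) • a 0) _ ?_ ?_ ?_ ?_ x hx,
      hle (s₀ • a 0 + (1 - s₁) • a 1) _ ?_ ?_ ?_ ?_ x hx⟩
    all_goals simp only [LinearMap.add_apply, LinearMap.smul_apply, smul_eq_mul]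
    any_goals
      simp only [p₀, p₁, p₂, Matrix.cons_val]
      linarith
    · intro x hx
      exact add_le_add (mul_le_mul_of_nonneg_left (hx 1) h₁.1)
        (mul_le_mul_of_nonneg_left (hx 2) hu₂)
    · intro x hx
      exact add_le_add (mul_le_mul_of_nonneg_left (hx 2) h₂.1)
        (mul_le_mul_of_nonneg_left (hx 0) hu₀)
    · intro x hx
      exact add_le_add (mul_le_mul_of_nonneg_left (hx 0) h₀.1)
        (mul_le_mul_of_nonneg_left (hx 1) hu₁)
  have hP12 : a 1 (P₁ - P₂) - a 2 (P₁ - P₂) = 3 * (1 + e) := by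
    rw [map_sub, map_sub, p₁, p₁, p₂, p₂]
    simp only [Matrix.cons_val]
    linarith
  refine ⟨⟨A, convex_convexHull ℝ _, hcomp, hne⟩, ⟨P₁, m₁, P₂, m₂, ?_⟩, ?_, ?_, ?_⟩
  · rintro rfl
    simp only [sub_self, map_zero] at hP12
    linarith
  · have := ha.circumradius_eq (h := fun _ => 1) hone (fun i => by
      fin_cases i
      exacts [⟨P₀, m₀, by simp [p₀]⟩, ⟨P₁, m₁, by simp [p₁]⟩, ⟨P₂, m₂, by simp [p₂]⟩])
    refine this.trans ?_
    norm_num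
  · refine le_antisymm (csSup_le ⟨ρ, hρ, t, hTA⟩ ?_) (ha.le_inradius hcomp hne hρ hTA)
    rintro σ ⟨hσ, u, hu⟩
    -- Each normal is tested at the vertex of `u + σ S` where two of the `a i` are maximal.
    have hvert : ∀ c : Fin 3 → ℝ, c 0 + c 1 + c 2 = 0 → (∀ i, c i ≤ a i u + σ) →
        ∃ x ∈ A, ∀ i, a i x = c i := by
      intro c hc hcu
      obtain ⟨x, hx⟩ := ha.exists_eq c hc
      exact ⟨x, hu ((ha.mem_vadd_smul_iff hσ u x).2 fun i => (hx i).trans_le (hcu i)), hx⟩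
    have su := ha.sum_eq_zero u
    obtain ⟨x, hx, hxa⟩ := hvert ![a 0 u - 2 * σ, a 1 u + σ, a 2 u + σ]
      (by simp only [Matrix.cons_val]; linarith)
      (fun i => by fin_cases i <;> simp; linarith)
    obtain ⟨y, hy, hya⟩ := hvert ![a 0 u + σ, a 1 u - 2 * σ, a 2 u + σ]
      (by simp only [Matrix.cons_val]; linarith)
      (fun i => by fin_cases i <;> simp; linarith)
    obtain ⟨z, hz, hza⟩ := hvert ![a 0 u + σ, a 1 u + σ, a 2 u - 2 * σ]
      (by simp only [Matrix.cons_val]; linarith)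
      (fun i => by fin_cases i <;> simp; linarith)
    have x' := (hnorm x hx).1
    have y' := (hnorm y hy).2.1
    have z' := (hnorm z hz).2.2
    rw [hxa, hxa] at x'
    rw [hya, hya] at y'
    rw [hza, hza] at z'
    simp only [Matrix.cons_val] at x' y' z'
    linarith
  · refine le_antisymm ((ha.harmonicDiameter_le_iff hcomp hne _).2 fun x hx y hy i j => ?_) ?_
    · rw [map_sub, map_sub]
      linarith [hdiff x hx j i, hdiff y hy i j]
    · have := (ha.harmonicDiameter_le_iff hcomp hne _).1 le_rfl P₁ m₁ P₂ m₂ 1 2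
      rw [hP12] at this
      exact (by linarith : 3 / 2 * (1 + e) ≤ harmonicDiameter A S)

/-- Every admissible pair of inradius and diameter occurs with circumradius `1`. The extremal
triangles degenerate to a segment at `e = 1 / 2`; beyond that the inradius may vanish. -/
theorem exists_convexBody_of_le (ha : IsTriangleFunctionals S a) {e ρ : ℝ} (he : 0 ≤ e)
    (he1 : e ≤ 1) (hρ : 0 ≤ ρ) (hρe : ρ ≤ (1 + e) / 2) (hlow : 1 / 4 - e ^ 2 ≤ ρ) :
    ∃ K : ConvexBody Plane, (K : Set Plane).Nontrivial ∧ circumradius (K : Set Plane) S = 1 ∧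
      inradius (K : Set Plane) S = ρ ∧ harmonicDiameter (K : Set Plane) S = 3 / 2 * (1 + e) := by
  -- The homothet of ratio `(1 + e) / 2` given by `n` is placed so that its ranges of the
  -- differences `l i - l j`, all of length `1 + e`, contain those of the inscribed triangle.
  rcases le_total e (1 / 2) with h | h
  · refine ha.exists_convexBody (s₀ := 1 / 2 + e) (s₁ := 1 / 2) (s₂ := 1 / 2 - e)
      (n := ![(1 - 2 * e) / 6, (1 + e) / 6, (1 - 2 * e) / 6]) he hρ
      ⟨by linarith, by linarith⟩ ⟨by linarith, by linarith⟩ ⟨by linarith, by linarith⟩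
      (by ring) ?_ ?_ ?_ ?_ ?_ ?_ (by linarith) hρe (by nlinarith)
    · intro i
      fin_cases i <;> simp <;> linarith
    · simp only [Matrix.cons_val]
      ring
    · intro i
      fin_cases i <;> simp <;> nlinarith
    all_goals
      intro i j
      fin_cases i <;> fin_cases j <;> simp <;> linarith
  · refine ha.exists_convexBody (s₀ := 1) (s₁ := e) (s₂ := 0)
      (n := ![0, (1 - e) / 2, 0]) he hρ
      ⟨by linarith, by linarith⟩ ⟨by linarith, by linarith⟩ ⟨by linarith, by linarith⟩
      (by ring) ?_ ?_ ?_ ?_ ?_ ?_ (by linarith) hρe (by linarith)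
    · intro i
      fin_cases i <;> simp
      linarith
    · simp only [Matrix.cons_val]
      ring
    · intro i
      fin_cases i <;> simp
      linarith
    all_goals
      intro i j
      fin_cases i <;> fin_cases j <;> simp <;> linarith

end IsTriangleFunctionals

theorem mainTheorem5 (S : Set Plane) (hS : IsTriangle S) (hc : IsMinkowskiCentered S) :
    (∀ K : ConvexBody Plane, (K : Set Plane).Nontrivial →
      0 < circumradius (K : Set Plane) S ∧
      HarmonicTriangleSystem (inradius (K : Set Plane) S) (circumradius (K : Set Plane) S)
        (harmonicDiameter (K : Set Plane) S)) ∧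
    harmonicDiagram S =
      {p : ℝ × ℝ | ∃ r R D : ℝ, 0 < R ∧ HarmonicTriangleSystem r R D ∧
        p = (r / R, D / (2 * R))} := by
  obtain ⟨a, ha⟩ := hS.exists_functionals hc
  refine ⟨fun K hK => ha.harmonicTriangleSystem K hK, Set.Subset.antisymm ?_ ?_⟩
  · rintro _ ⟨K, hK, rfl⟩
    exact ⟨_, _, _, (ha.harmonicTriangleSystem K hK).1, (ha.harmonicTriangleSystem K hK).2, rfl⟩
  · rintro _ ⟨r, R, D, hR, ⟨h1, h2, h3, h4, h5⟩, rfl⟩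
    have h1' : D / R ≤ 3 := (div_le_iff₀ hR).2 h1
    have h2' : 3 * (r / R) ≤ D / R := by
      rw [← mul_div_assoc]
      exact div_le_div_of_nonneg_right h2 hR.le
    have h4' : 3 / 2 ≤ D / R := (le_div_iff₀ hR).2 (by linarith)
    obtain ⟨K, hK, hKR, hKr, hKD⟩ := ha.exists_convexBody_of_le (e := 2 / 3 * (D / R) - 1)
      (ρ := r / R) (by linarith) (by linarith) (div_nonneg h3 hR.le) (by linarith)
      (by linarith)
    refine ⟨K, hK, ?_⟩
    rw [hKR, hKr, hKD, div_one, Prod.mk.injEq]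
    refine ⟨rfl, ?_⟩
    field_simp
    ring
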